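/- Throughout, $L^2(0,\infty)$ is the complex Hilbert space. Let $\phi_1,\phi_2\in L^2(0,\infty)$ be positive continuous functions on $[0,\infty)$ with weak derivatives in $L^2_{\rm loc}[0,\infty)$; that is, for $r=1,2$ there is a function $g_r$ with $g_r\in L^2(0,a)$ for all $a>0$ and $\phi_r(x)=\phi_r(0)+\int_0^x g_r(s)\,ds$ for all $x\ge 0$. Put $$\psi_r(x)=\phi_r(x)\int_0^x\frac{ds}{\phi_r(s)^2},\qquad G_r(x,y)=\begin{cases}\psi_r(x)\phi_r(y)&\text{if } 0\le x\le y<\infty,\\ \phi_r(x)\psi_r(y)&\text{if } 0\le y\le x<\infty.\end{cases}$$ We say that $G_r$ is bounded (resp. compact) if $G_r(\cdot,\cdot)$ is the integral kernel of a bounded (resp. compact) operator on $L^2(0,\infty)$, which is then also denoted by $G_r$; that is, for every $f\in L^2(0,\infty)$, $(G_rf)(x)=\int_0^\infty G_r(x,y)f(y)\,dy$ for almost all $x>0$, the integral being absolutely convergent. Suppose that there is a constant $c>0$ such that $c^{-1}\le \phi_2(x)/\phi_1(x)\le c$ for all $x\ge 0$. Then $G_1$ is bounded if and only if $G_2$ is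 bounded, and $G_1$ is compact if and only if $G_2$ is compact. If $G_1$ and $G_2$ are compact, then for each $r\in\{1,2\}$ the eigenvalues of $G_r$ can be written as an infinite decreasing (that is, non-increasing) sequence of real numbers $\mu_{r,1}\ge\mu_{r,2}\ge\cdots$ in which every eigenvalue is repeated according to its multiplicity, and $$c^{-4}\mu_{1,n}\le\mu_{2,n}\le c^{4}\mu_{1,n}\qquad\text{for all } n\ge 1.$$ -/

import Mathlib

open MeasureTheory Set

noncomputable section

/-- The complex Hilbert space `L²(0,∞)`. -/
abbrev HalfLineL2 : Type := Lp ℂ 2 (volume.restrict (Ioi (0 : ℝ)))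

/-- `W^{1,2}_loc[0,∞)`: `f` is continuous on `[0,∞)` and is the indefinite integral of some
`g ∈ L²_loc[0,∞)`, the weak derivative of `f`. Only the values of `f` on `[0,∞)` matter. -/
def MemW12Loc (f : ℝ → ℝ) : Prop :=
  ContinuousOn f (Ici 0) ∧
    ∃ g : ℝ → ℝ, (∀ a : ℝ, 0 ≤ a → MemLp g 2 (volume.restrict (Icc 0 a))) ∧
      ∀ x : ℝ, 0 ≤ x → f x = f 0 + ∫ s in (0 : ℝ)..x, g s

/-- The standing hypothesis on `φ`: positive and continuous on `[0,∞)`, in `L²(0,∞)`,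
with weak derivative in `L²_loc[0,∞)`. -/
structure IsSubordinate (φ : ℝ → ℝ) : Prop where
  pos : ∀ x : ℝ, 0 ≤ x → 0 < φ x
  memW12Loc : MemW12Loc φ
  memL2 : MemLp φ 2 (volume.restrict (Ioi (0 : ℝ)))

/-- The second solution `ψ(x) = φ(x) ∫₀ˣ φ(s)⁻² ds`. -/
def secondSolution (φ : ℝ → ℝ) (x : ℝ) : ℝ :=
  φ x * ∫ s in (0 : ℝ)..x, 1 / φ s ^ 2

/-- The Green function (Dirichlet condition at `0`): `ψ(x) φ(y)` for `x ≤ y` and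
`φ(x) ψ(y)` for `y ≤ x`. -/
def greenFunction (φ : ℝ → ℝ) (x y : ℝ) : ℝ :=
  if x ≤ y then secondSolution φ x * φ y else φ x * secondSolution φ y

/-- The bounded operator `T` on `L²(0,∞)` has integral kernel `K`: for every `f`,
`(T f)(x) = ∫₀^∞ K(x,y) f(y) dy` for almost all `x > 0`, with absolutely convergent integrals. -/
def HasIntegralKernel (T : HalfLineL2 →L[ℂ] HalfLineL2) (K : ℝ → ℝ → ℝ) : Prop :=
  ∀ f : HalfLineL2, ∀ᵐ x ∂(volume.restrict (Ioi (0 : ℝ))),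
    Integrable (fun y : ℝ => (K x y : ℂ) * f y) (volume.restrict (Ioi (0 : ℝ))) ∧
      T f x = ∫ y in Ioi (0 : ℝ), (K x y : ℂ) * f y

/-- The Green function of `φ` is the kernel of a bounded operator on `L²(0,∞)`. -/
def GreenBounded (φ : ℝ → ℝ) : Prop :=
  ∃ T : HalfLineL2 →L[ℂ] HalfLineL2, HasIntegralKernel T (greenFunction φ)

/-- The Green function of `φ` is the kernel of a compact operator on `L²(0,∞)`. -/
def GreenCompact (φ : ℝ → ℝ) : Prop :=
  ∃ T : HalfLineL2 →L[ℂ] HalfLineL2, HasIntegralKernel T (greenFunction φ) ∧ IsCompactOperator T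

/-- `μ 0 ≥ μ 1 ≥ …` are all the eigenvalues of `T`, repeated according to multiplicity: every
complex number `z` occurs in the sequence exactly `dim ker (T - z)` times (so not at all
if it is not an eigenvalue). -/
def IsEigenvalueSequence (T : HalfLineL2 →L[ℂ] HalfLineL2) (μ : ℕ → ℝ) : Prop :=
  Antitone μ ∧ ∀ z : ℂ,
    Cardinal.mk {n : ℕ // (μ n : ℂ) = z} =
      Module.rank ℂ (Module.End.eigenspace (T : HalfLineL2 →ₗ[ℂ] HalfLineL2) z)

end

open scoped InnerProductSpace ENNReal

/-! ### Compact self-adjoint operators: eigenbases, form comparison -/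

section Spectral

variable {H : Type} [NormedAddCommGroup H] [InnerProductSpace ℂ H]

/-! The kernel is `φ(x) φ(y) ∫₀^{min(x,y)} φ⁻²`, so Fubini gives `⟪G f, f⟫ = ∫ φ(s)⁻² |∫ₛ^∞ φ f|²
ds` (`HasIntegralKernel.inner_self_eq`). If `M` is multiplication by `φ₂/φ₁`, then `φ₁ · M f = φ₂
f`; the tail integrals agree and only the weights differ, whence `⟪G₂ f, f⟫ ≤ c² ⟪G₁ M f, M f⟫` with
`‖M f‖ ≤ c ‖f‖` (`ComparableBy.exists_inner_self_le`).

A min-max argument turns this into `μ₂ ≤ c⁴ μ₁` (`eigenvalue_le_of_quadratic_form_le`), and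
domination by a compact operator gives compactness (`IsCompactOperator.of_quadratic_form_le`).
Boundedness needs only the pointwise bound between nonnegative kernels
(`exists_operator_of_dominated_kernel`). The form is strictly positive, so zero is not an eigenvalue
and the positive eigenvalues, sorted, are all of them. Everything else follows by exchanging the two
functions. -/

theorem Orthonormal.finite_setOf_le_eigenvalue {ι : Type*} {v : ι → H} (hv : Orthonormal ℂ v)
    {T : H →L[ℂ] H} (hT : IsCompactOperator T) {l : ι → ℝ}
    (hl : ∀ i, T (v i) = (l i : ℂ) • v i) {ε : ℝ} (hε : 0 < ε) : {i | ε ≤ l i}.Finite := by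
  by_contra hinf
  let f := Set.Infinite.natEmbedding _ hinf
  have hK := hT.isCompact_closure_image_closedBall (𝕜₁ := ℂ) (f := (T : H →ₗ[ℂ] H)) 1
  obtain ⟨a, -, φ, hφ, hlim⟩ := hK.tendsto_subseq (x := fun n => T (v (f n))) (fun n =>
    subset_closure ⟨v (f n), by simp [hv.1], rfl⟩)
  obtain ⟨N, hN⟩ := Metric.cauchySeq_iff.1 hlim.cauchySeq ε hε
  have h := hN N le_rfl (N + 1) (Nat.le_succ N)
  have hne : (f (φ N) : ι) ≠ f (φ (N + 1)) := fun h => by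
    have := hφ.injective (f.injective (Subtype.ext h))
    omega
  have h1 : ε ≤ l (f (φ N)) := (f (φ N)).2
  simp only [Function.comp, hl, dist_eq_norm] at h
  -- Pythagoras: the images of two distinct basis vectors are at least `ε` apart, so no subsequence
  -- is Cauchy.
  have h2 := norm_sub_mul_self (𝕜 := ℂ) ((l (f (φ N)) : ℂ) • v (f (φ N)))
    ((l (f (φ (N + 1))) : ℂ) • v (f (φ (N + 1))))
  rw [inner_smul_left, inner_smul_right, hv.2 hne] at h2
  simp only [norm_smul, hv.1, Complex.norm_real, Real.norm_eq_abs, mul_one, mul_zero, map_zero,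
    abs_mul_abs_self, sub_zero] at h2
  nlinarith [norm_nonneg ((l (f (φ N)) : ℂ) • v (f (φ N)) -
    (l (f (φ (N + 1))) : ℂ) • v (f (φ (N + 1)))), sq_nonneg (l (f (φ (N + 1))))]

/-- Hilbert bases of the eigenspaces are glued together; the union is total because the eigenspaces
of a compact self-adjoint operator have no common nonzero orthogonal vector. -/
theorem exists_hilbertBasis_eigenvectors [CompleteSpace H] {T : H →L[ℂ] H}
    (hT : IsCompactOperator T) (hs : (T : H →ₗ[ℂ] H).IsSymmetric) :
    ∃ (ι : Type) (b : HilbertBasis ι ℂ H) (l : ι → ℝ), ∀ i, T (b i) = (l i : ℂ) • b i := by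
  have hcl : ∀ z : ℂ, CompleteSpace (Module.End.eigenspace (T : H →ₗ[ℂ] H) z) := fun z => by
    refine IsClosed.completeSpace_coe (hs := ?_)
    have : (Module.End.eigenspace (T : H →ₗ[ℂ] H) z : Set H) = {x | T x = z • x} := by
      ext x; simp
    rw [this]
    exact isClosed_eq (by fun_prop) (by fun_prop)
  choose w B hB using fun z : ℂ => exists_hilbertBasis ℂ (Module.End.eigenspace (T : H →ₗ[ℂ] H) z)
  have hv := hs.orthogonalFamily_eigenspaces.orthonormal_sigma_orthonormal
    (v_family := fun z => B z) (fun z => (B z).orthonormal)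
  refine ⟨Σ z : ℂ, w z, HilbertBasis.mkOfOrthogonalEqBot hv ?_, fun i => i.1.re, ?_⟩
  · rw [eq_bot_iff, ← ContinuousLinearMap.orthogonalComplement_iSup_eigenspaces_eq_bot hT hs]
    intro x hx
    rw [Submodule.mem_orthogonal'] at hx
    rw [← Submodule.iInf_orthogonal, Submodule.mem_iInf]
    intro z
    rw [Submodule.mem_orthogonal']
    intro y hy
    have h1 := ((B z).hasSum_repr ⟨y, hy⟩).mapL
      ((innerSL ℂ x).comp (Module.End.eigenspace (T : H →ₗ[ℂ] H) z).subtypeL)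
    have h2 : ∀ i, ((innerSL ℂ x).comp (Module.End.eigenspace (T : H →ₗ[ℂ] H) z).subtypeL)
        ((B z).repr ⟨y, hy⟩ i • B z i) = 0 := fun i => by
      have := hx _ (Submodule.subset_span ⟨⟨z, i⟩, rfl⟩)
      simp only [Submodule.coe_subtypeₗᵢ, Submodule.subtype_apply] at this
      simp [this]
    simp only [h2] at h1
    simpa using h1.unique hasSum_zero
  · rintro ⟨z, i⟩
    simp only [HilbertBasis.coe_mkOfOrthogonalEqBot, Submodule.coe_subtypeₗᵢ,
      Submodule.subtype_apply]
    have hmem : T (B z i : H) = z • (B z i : H) := Module.End.mem_eigenspace_iff.1 (B z i).2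
    have hne : (B z i : H) ≠ 0 := fun h => (B z).orthonormal.ne_zero i (Subtype.ext h)
    have hz := hs.conj_eigenvalue_eq_self
      (Module.End.hasEigenvalue_of_hasEigenvector ⟨(B z i).2, hne⟩)
    rw [hmem, Complex.conj_eq_iff_re.1 hz]

theorem exists_equiv_nat_antitone {ι : Type} [Infinite ι] {l : ι → ℝ} (hpos : ∀ i, 0 < l i)
    (hfin : ∀ ε : ℝ, 0 < ε → {i | ε ≤ l i}.Finite) : ∃ e : ℕ ≃ ι, Antitone (l ∘ e) := by
  have hcount : Countable ι := by
    rw [← Set.countable_univ_iff]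
    have : (univ : Set ι) = ⋃ n : ℕ, {i | 1 / ((n : ℝ) + 1) ≤ l i} := by
      ext i
      obtain ⟨n, hn⟩ := exists_nat_one_div_lt (hpos i)
      simpa using ⟨n, by simpa using hn.le⟩
    rw [this]
    exact countable_iUnion fun n => (hfin _ (by positivity)).countable
  obtain ⟨enc, henc⟩ := hcount.exists_injective_nat
  -- Larger `l` comes first and ties are broken by the enumeration. Each index has finitely many
  -- predecessors, and their number is its rank.
  let key : ι → ℝ ×ₗ ℕ := fun i => toLex (-l i, enc i)
  have hkey : Function.Injective key := fun i j h => henc (by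
    have := congrArg (fun t => (ofLex t).2) h
    simpa [key] using this)
  have hle : ∀ {i j}, key i ≤ key j → l j ≤ l i := fun {i j} h => by
    rcases Prod.Lex.toLex_le_toLex.1 h with h | h
    · simpa using h.le
    · simpa using h.1.le
  have hF : ∀ i, {j | key j < key i}.Finite := fun i =>
    (hfin (l i) (hpos i)).subset fun j hj => hle (le_of_lt hj)
  let r : ι → ℕ := fun i => {j | key j < key i}.ncard
  have hr : ∀ {i j}, key i < key j → r i < r j := fun {i j} h =>
    Set.ncard_lt_ncard ⟨fun k hk => lt_trans hk h, fun hsub => lt_irrefl (key i) (hsub h)⟩ (hF j)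
  have hri : Function.Injective r := fun i j h => by
    by_contra hne
    rcases lt_or_gt_of_ne (hkey.ne hne) with h' | h'
    · exact (hr h').ne h
    · exact (hr h').ne' h
  classical
  have : Infinite (range r) := Set.infinite_coe_iff.2 (Set.infinite_range_of_injective hri)
  let o := Nat.Subtype.orderIsoOfNat (range r)
  let q := Equiv.ofInjective r hri
  refine ⟨o.toEquiv.trans q.symm, fun m n hmn => ?_⟩
  have h1 : ∀ n, r (q.symm (o n)) = o n := fun n =>
    congrArg Subtype.val (q.apply_symm_apply (o n))
  refine hle (le_of_not_gt fun hlt => ?_)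
  have h2 := hr hlt
  change r (q.symm (o n)) < r (q.symm (o m)) at h2
  rw [h1, h1] at h2
  exact absurd (o.monotone hmn) (not_le_of_gt h2)

/-- An eigenvector has no component along basis vectors with another eigenvalue. Finiteness makes
its expansion a finite sum, so algebraic rank is the right count. -/
theorem HilbertBasis.rank_eigenspace {ι : Type} (b : HilbertBasis ι ℂ H) {T : H →L[ℂ] H}
    (hs : (T : H →ₗ[ℂ] H).IsSymmetric) {l : ι → ℝ} (hl : ∀ i, T (b i) = (l i : ℂ) • b i) {z : ℂ}
    (hfin : {i | (l i : ℂ) = z}.Finite) :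
    Module.rank ℂ (Module.End.eigenspace (T : H →ₗ[ℂ] H) z) =
      Cardinal.mk {i // (l i : ℂ) = z} := by
  have hspan : Module.End.eigenspace (T : H →ₗ[ℂ] H) z =
      Submodule.span ℂ (range fun i : {i // (l i : ℂ) = z} => b i) := by
    apply le_antisymm
    · intro f hf
      have hTf : T f = z • f := Module.End.mem_eigenspace_iff.1 hf
      have h0 : ∀ i ∉ hfin.toFinset, b.repr f i • b i = 0 := fun i hi => by
        have hi' : (l i : ℂ) ≠ z := by simpa using hi
        have h1 : ⟪b i, T f⟫_ℂ = l i * ⟪b i, f⟫_ℂ := by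
          have := hs (b i) f
          simp only [ContinuousLinearMap.coe_coe] at this
          rw [← this, hl, inner_smul_left, Complex.conj_ofReal]
        rw [hTf, inner_smul_right] at h1
        rw [b.repr_apply_apply]
        have : (z - l i) * ⟪b i, f⟫_ℂ = 0 := by rw [sub_mul, h1, sub_self]
        rcases mul_eq_zero.1 this with h | h
        · exact absurd (sub_eq_zero.1 h).symm hi'
        · rw [h, zero_smul]
      have h2 := (hasSum_sum_of_ne_finset_zero h0).unique (b.hasSum_repr f)
      rw [← h2]
      refine Submodule.sum_mem _ fun i hi => Submodule.smul_mem _ _ (Submodule.subset_span ?_)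
      exact ⟨⟨i, by simpa using hi⟩, rfl⟩
    · rw [Submodule.span_le]
      rintro _ ⟨⟨i, rfl⟩, rfl⟩
      exact Module.End.mem_eigenspace_iff.2 (hl i)
  have hli : LinearIndependent ℂ fun i : {i // (l i : ℂ) = z} => b i :=
    b.orthonormal.linearIndependent.comp _ Subtype.val_injective
  rw [hspan, rank_span hli, Cardinal.mk_range_eq _ hli.injective]

theorem exists_hilbertBasis_antitone_eigenvalues [CompleteSpace H]
    (hH : ¬ FiniteDimensional ℂ H) {T : H →L[ℂ] H}
    (hT : IsCompactOperator T) (hs : (T : H →ₗ[ℂ] H).IsSymmetric)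
    (hpos : ∀ f ≠ 0, 0 < (⟪T f, f⟫_ℂ).re) :
    ∃ (b : HilbertBasis ℕ ℂ H) (μ : ℕ → ℝ), Antitone μ ∧ (∀ n, T (b n) = (μ n : ℂ) • b n) ∧
      ∀ z : ℂ, Cardinal.mk {n : ℕ // (μ n : ℂ) = z} =
        Module.rank ℂ (Module.End.eigenspace (T : H →ₗ[ℂ] H) z) := by
  obtain ⟨ι, b, l, hl⟩ := exists_hilbertBasis_eigenvectors hT hs
  have hlpos : ∀ i, 0 < l i := fun i => by
    have := hpos (b i) (b.orthonormal.ne_zero i)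
    rw [hl, inner_smul_left, Complex.conj_ofReal, inner_self_eq_norm_sq_to_K,
      b.orthonormal.1] at this
    simpa using this
  have hfin : ∀ ε : ℝ, 0 < ε → {i | ε ≤ l i}.Finite := fun ε hε =>
    b.orthonormal.finite_setOf_le_eigenvalue hT hl hε
  have hinf : Infinite ι := by
    by_contra h
    rw [not_infinite_iff_finite] at h
    have := Fintype.ofFinite ι
    exact hH b.toOrthonormalBasis.toBasis.finiteDimensional_of_finite
  obtain ⟨e, he⟩ := exists_equiv_nat_antitone hlpos hfin
  have hr : range (fun n => b (e n)) = range b := e.surjective.range_comp b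
  have hc : Orthonormal ℂ fun n => b (e n) := b.orthonormal.comp _ e.injective
  let b' : HilbertBasis ℕ ℂ H := HilbertBasis.mk hc (by rw [hr, b.dense_span])
  have hb' : ∀ n, b' n = b (e n) := fun n => by simp [b']
  have hl' : ∀ n, T (b' n) = ((l (e n) : ℝ) : ℂ) • b' n := fun n => by rw [hb', hl]
  refine ⟨b', l ∘ e, he, hl', fun z => (b'.rank_eigenspace hs hl' ?_).symm⟩
  -- Finiteness of fibres could fail only at zero; there, and wherever `z.re ≤ 0`, positivity makes
  -- the fibre empty.
  by_cases hz : 0 < z.re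
  · refine ((hfin z.re hz).preimage e.injective.injOn).subset ?_
    rintro n rfl
    simp
  · convert Set.finite_empty
    ext n
    simp only [mem_ofPred_eq, mem_empty_iff_false, iff_false]
    rintro rfl
    exact hz (by simpa using hlpos (e n))

/-- Equal multiplicities give a bijection on each fibre; together these form a permutation of the
indices, which reorders the basis. -/
theorem HilbertBasis.exists_of_mk_eq_mk [CompleteSpace H] (b : HilbertBasis ℕ ℂ H) {T : H →L[ℂ] H} {μ ν : ℕ → ℝ}
    (hb : ∀ n, T (b n) = (μ n : ℂ) • b n)
    (h : ∀ z : ℂ, Cardinal.mk {n : ℕ // (ν n : ℂ) = z} = Cardinal.mk {n : ℕ // (μ n : ℂ) = z}) :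
    ∃ b' : HilbertBasis ℕ ℂ H, ∀ n, T (b' n) = (ν n : ℂ) • b' n := by
  have h' := fun z => Cardinal.eq.1 (h z)
  let σ : ℕ ≃ ℕ := (Equiv.sigmaFiberEquiv fun n => (ν n : ℂ)).symm.trans
    ((Equiv.sigmaCongrRight fun z => (h' z).some).trans (Equiv.sigmaFiberEquiv fun n => (μ n : ℂ)))
  have hσ : ∀ n, (μ (σ n) : ℂ) = ν n := fun n => ((h' (ν n)).some ⟨n, rfl⟩).2
  have hr : range (fun n => b (σ n)) = range b := σ.surjective.range_comp b
  refine ⟨HilbertBasis.mk (b.orthonormal.comp _ σ.injective) ?_, fun n => ?_⟩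
  · change _ ≤ (Submodule.span ℂ (range (fun n => b (σ n)))).topologicalClosure
    rw [hr, b.dense_span]
  · simp [hb, hσ]

theorem HilbertBasis.hasSum_eigenvalue_mul_sq {ι : Type} (b : HilbertBasis ι ℂ H) {T : H →L[ℂ] H}
    (hs : (T : H →ₗ[ℂ] H).IsSymmetric) {l : ι → ℝ} (hl : ∀ i, T (b i) = (l i : ℂ) • b i) (f : H) :
    HasSum (fun i => l i * ‖⟪b i, f⟫_ℂ‖ ^ 2) (⟪T f, f⟫_ℂ).re := by
  convert Complex.hasSum_re (b.hasSum_inner_mul_inner (T f) f) using 2 with i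
  have h := hs f (b i)
  simp only [ContinuousLinearMap.coe_coe] at h
  rw [h, hl, inner_smul_right, mul_assoc, Complex.re_ofReal_mul]
  have h2 := inner_mul_symm_re_eq_norm (𝕜 := ℂ) f (b i)
  rw [norm_mul, norm_inner_symm f, ← sq] at h2
  rw [← h2]
  rfl

theorem HilbertBasis.hasSum_norm_inner_sq {ι : Type} (b : HilbertBasis ι ℂ H) (f : H) :
    HasSum (fun i => ‖⟪b i, f⟫_ℂ‖ ^ 2) (‖f‖ ^ 2) := by
  have h := b.hasSum_eigenvalue_mul_sq (T := ContinuousLinearMap.id ℂ H) (l := fun _ => 1)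
    (fun _ _ => rfl) (fun i => by simp) f
  simp only [ContinuousLinearMap.id_apply, one_mul] at h
  rwa [← RCLike.re_eq_complex_re, inner_self_eq_norm_sq] at h

/-- Min-max with a test vector: the span of the first `n + 1` vectors of `b₂` contains a nonzero `f`
with `M f` orthogonal to the first `n` vectors of `b₁`. One factor `c` comes from the forms, the
other from `‖M f‖²`. -/
theorem eigenvalue_le_of_quadratic_form_le {T₁ T₂ : H →L[ℂ] H}
    (hs₁ : (T₁ : H →ₗ[ℂ] H).IsSymmetric) (hs₂ : (T₂ : H →ₗ[ℂ] H).IsSymmetric)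
    {b₁ b₂ : HilbertBasis ℕ ℂ H} {μ₁ μ₂ : ℕ → ℝ}
    (hb₁ : ∀ n, T₁ (b₁ n) = (μ₁ n : ℂ) • b₁ n) (hb₂ : ∀ n, T₂ (b₂ n) = (μ₂ n : ℂ) • b₂ n)
    (hμ₁ : Antitone μ₁) (hμ₂ : Antitone μ₂) (hpos : ∀ n, 0 ≤ μ₁ n)
    (M : H →L[ℂ] H) {c : ℝ} (hc : 0 ≤ c) (hM : ∀ f, ‖M f‖ ^ 2 ≤ c * ‖f‖ ^ 2)
    (hle : ∀ f, (⟪T₂ f, f⟫_ℂ).re ≤ c * (⟪T₁ (M f), M f⟫_ℂ).re) (n : ℕ) :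
    μ₂ n ≤ c ^ 2 * μ₁ n := by
  let L : (Fin (n + 1) → ℂ) →ₗ[ℂ] H := Fintype.linearCombination ℂ (fun i : Fin (n + 1) => b₂ i)
  have hLapp : ∀ a, L a = ∑ i, a i • b₂ i := fun a => rfl
  have hLinj : LinearMap.ker L = ⊥ := by
    have : LinearIndependent ℂ (fun i : Fin (n + 1) => b₂ i) :=
      b₂.orthonormal.linearIndependent.comp _ Fin.val_injective
    rw [LinearMap.ker_eq_bot]
    exact this.fintypeLinearCombination_injective
  let Q : (Fin (n + 1) → ℂ) →ₗ[ℂ] (Fin n → ℂ) := LinearMap.pi fun k =>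
    ((innerSL ℂ (b₁ k)).comp M : H →L[ℂ] ℂ).toLinearMap.comp L
  have hQ : LinearMap.ker Q ≠ ⊥ := LinearMap.ker_ne_bot_of_finrank_lt (by simp)
  obtain ⟨a, haQ, ha0⟩ := (Submodule.ne_bot_iff _).1 hQ
  set f := L a with hf
  have hf0 : f ≠ 0 := fun h => ha0 (by
    have : a ∈ LinearMap.ker L := h
    rwa [hLinj, Submodule.mem_bot] at this)
  have horth₁ : ∀ k < n, ⟪b₁ k, M f⟫_ℂ = 0 := fun k hk =>
    congrFun (LinearMap.mem_ker.1 haQ) (⟨k, hk⟩ : Fin n)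
  have horth₂ : ∀ k, n < k → ⟪b₂ k, f⟫_ℂ = 0 := fun k hk => by
    rw [hf, hLapp, inner_sum]
    refine Finset.sum_eq_zero fun i _ => ?_
    rw [inner_smul_right, b₂.orthonormal.2 (by have := i.2; omega), mul_zero]
  have h1 : μ₂ n * ‖f‖ ^ 2 ≤ (⟪T₂ f, f⟫_ℂ).re := by
    refine hasSum_le (fun k => ?_) ((b₂.hasSum_norm_inner_sq f).mul_left (μ₂ n))
      (b₂.hasSum_eigenvalue_mul_sq hs₂ hb₂ f)
    rcases le_or_gt k n with hk | hk
    · exact mul_le_mul_of_nonneg_right (hμ₂ hk) (by positivity)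
    · simp [horth₂ k hk]
  have h2 : (⟪T₁ (M f), M f⟫_ℂ).re ≤ μ₁ n * ‖M f‖ ^ 2 := by
    refine hasSum_le (fun k => ?_) (b₁.hasSum_eigenvalue_mul_sq hs₁ hb₁ (M f))
      ((b₁.hasSum_norm_inner_sq (M f)).mul_left (μ₁ n))
    rcases lt_or_ge k n with hk | hk
    · simp [horth₁ k hk]
    · exact mul_le_mul_of_nonneg_right (hμ₁ hk) (by positivity)
  have hfpos : 0 < ‖f‖ ^ 2 := by positivity
  refine le_of_mul_le_mul_right ?_ hfpos
  calc μ₂ n * ‖f‖ ^ 2 ≤ c * (μ₁ n * ‖M f‖ ^ 2) :=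
        h1.trans ((hle f).trans (mul_le_mul_of_nonneg_left h2 hc))
    _ ≤ c * (μ₁ n * (c * ‖f‖ ^ 2)) :=
        mul_le_mul_of_nonneg_left (mul_le_mul_of_nonneg_left (hM f) (hpos n)) hc
    _ = c ^ 2 * μ₁ n * ‖f‖ ^ 2 := by ring

theorem norm_apply_sq_le_of_nonneg {S : H →L[ℂ] H} (hs : (S : H →ₗ[ℂ] H).IsSymmetric)
    (hpos : ∀ f, 0 ≤ (⟪S f, f⟫_ℂ).re) (f : H) :
    ‖S f‖ ^ 2 ≤ (‖S‖ + 1) * (⟪S f, f⟫_ℂ).re := by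
  set t : ℝ := (‖S‖ + 1)⁻¹ with ht
  have hC : 0 < ‖S‖ + 1 := by positivity
  have ht0 : 0 < t := by positivity
  have htC : t * (‖S‖ + 1) = 1 := inv_mul_cancel₀ hC.ne'
  -- Expanding the form at this vector bounds `t ‖S f‖²`. The `+ 1` in `t` covers `S = 0`.
  have h := hpos (f - (t : ℂ) • S f)
  have h1 : ⟪S (S f), f⟫_ℂ = ⟪S f, S f⟫_ℂ := hs (S f) f
  have h2 : (⟪S (S f), S f⟫_ℂ).re ≤ ‖S‖ * ‖S f‖ ^ 2 := by
    refine (Complex.re_le_norm _).trans ((norm_inner_le_norm _ _).trans ?_)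
    nlinarith [S.le_opNorm (S f), norm_nonneg (S f)]
  have h3 : (⟪S f, S f⟫_ℂ).re = ‖S f‖ ^ 2 := by
    rw [← RCLike.re_eq_complex_re, inner_self_eq_norm_sq]
  rw [map_sub, map_smul, inner_sub_left, inner_sub_right, inner_sub_right, inner_smul_left,
    inner_smul_right, inner_smul_left, inner_smul_right, h1, Complex.conj_ofReal] at h
  simp only [Complex.sub_re, Complex.re_ofReal_mul, h3] at h
  have h4 : t * (t * (⟪S (S f), S f⟫_ℂ).re) ≤ t * (t * (‖S‖ * ‖S f‖ ^ 2)) := by gcongr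
  have h5 : t * (t * (‖S‖ * ‖S f‖ ^ 2)) ≤ t * ‖S f‖ ^ 2 := by
    have : t * ‖S‖ ≤ 1 := by nlinarith
    have := mul_le_mul_of_nonneg_right this (by positivity : 0 ≤ t * ‖S f‖ ^ 2)
    nlinarith
  have h6 : t * ‖S f‖ ^ 2 ≤ (⟪S f, f⟫_ℂ).re := by linarith
  calc ‖S f‖ ^ 2 = (‖S‖ + 1) * (t * ‖S f‖ ^ 2) := by rw [← mul_assoc, mul_comm _ t, htC, one_mul]
    _ ≤ _ := mul_le_mul_of_nonneg_left h6 hC.le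

/-- By `norm_apply_sq_le_of_nonneg`, `‖S f‖²` is at most a constant times `‖K f‖ ‖f‖`; a finite net
for the image of the unit ball under `K` therefore yields one for `S`. -/
theorem IsCompactOperator.of_quadratic_form_le [CompleteSpace H] {S K : H →L[ℂ] H}
    (hK : IsCompactOperator K)
    (hs : (S : H →ₗ[ℂ] H).IsSymmetric) (hpos : ∀ f, 0 ≤ (⟪S f, f⟫_ℂ).re) {C : ℝ}
    (hle : ∀ f, (⟪S f, f⟫_ℂ).re ≤ C * (‖K f‖ * ‖f‖)) : IsCompactOperator S := by
  have hKtb : TotallyBounded (K '' Metric.closedBall 0 1) :=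
    (hK.isCompact_closure_image_closedBall (𝕜₁ := ℂ) (f := (K : H →ₗ[ℂ] H))
      1).totallyBounded.subset subset_closure
  refine (isCompactOperator_iff_isCompact_closure_image_closedBall (𝕜₁ := ℂ) (S : H →ₗ[ℂ] H)
    one_pos).2 (TotallyBounded.isCompact_of_isClosed (TotallyBounded.closure ?_) isClosed_closure)
  rw [Metric.totallyBounded_iff]
  intro ε hε
  -- The `2` bounds the distance of two points of the unit ball; the `+ 1` keeps `D` positive when
  -- `C = 0`.
  set D := (‖S‖ + 1) * (2 * |C|) + 1 with hD
  have hD0 : 0 < D := by positivity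
  obtain ⟨t, htsub, htfin, htcov⟩ := hKtb.exists_subset (Metric.dist_mem_uniformity
    (show 0 < ε ^ 2 / D by positivity))
  choose! g hg using fun y (hy : y ∈ t) => htsub hy
  refine ⟨(fun y => S (g y)) '' t, htfin.image _, ?_⟩
  rintro _ ⟨f, hf, rfl⟩
  obtain ⟨y, hy, hfy⟩ := mem_iUnion₂.1 (htcov ⟨f, hf, rfl⟩)
  rw [mem_iUnion₂]
  refine ⟨_, ⟨y, hy, rfl⟩, ?_⟩
  have hf1 : ‖f‖ ≤ 1 := by simpa using hf
  have hg1 : ‖g y‖ ≤ 1 := by simpa using (hg y hy).1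
  have hfy' : ‖K (f - g y)‖ < ε ^ 2 / D := by
    rw [map_sub, (hg y hy).2, ← dist_eq_norm]
    exact hfy
  rw [Metric.mem_ball, dist_eq_norm]
  change ‖S f - S (g y)‖ < ε
  rw [← map_sub]
  have h1 := norm_apply_sq_le_of_nonneg hs hpos (f - g y)
  have h2 : ‖f - g y‖ ≤ 2 := (norm_sub_le _ _).trans (by linarith)
  have h3 : (⟪S (f - g y), f - g y⟫_ℂ).re ≤ |C| * (‖K (f - g y)‖ * 2) :=
    (hle _).trans (mul_le_mul (le_abs_self C) (by gcongr) (by positivity) (by positivity))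
  have h4 : ‖S (f - g y)‖ ^ 2 ≤ (‖S‖ + 1) * (|C| * (‖K (f - g y)‖ * 2)) :=
    h1.trans (mul_le_mul_of_nonneg_left h3 (by positivity))
  have h5 : ‖K (f - g y)‖ * D < ε ^ 2 := (lt_div_iff₀ hD0).1 hfy'
  have h6 : ‖S (f - g y)‖ ^ 2 < ε ^ 2 := by
    rw [hD] at h5
    nlinarith [norm_nonneg (K (f - g y))]
  exact lt_of_pow_lt_pow_left₀ 2 hε.le h6

end Spectral

/-! ### Integral operators on the half-line -/

section HalfLine

/-- Lebesgue measure on `(0,∞)`. -/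
noncomputable abbrev halfLineMeasure : Measure ℝ := volume.restrict (Ioi (0 : ℝ))

theorem ae_halfLine_pos : ∀ᵐ x ∂halfLineMeasure, 0 < x := ae_restrict_mem measurableSet_Ioi

theorem ae_prod_halfLine_pos :
    ∀ᵐ z ∂(halfLineMeasure.prod halfLineMeasure), 0 < z.1 ∧ 0 < z.2 := by
  rw [Measure.prod_restrict]
  filter_upwards [ae_restrict_mem (measurableSet_Ioi.prod measurableSet_Ioi)] with z hz using hz

theorem exists_norm_lp (f : HalfLineL2) :
    ∃ F : HalfLineL2, (F =ᵐ[halfLineMeasure] fun x => ((‖f x‖ : ℝ) : ℂ)) ∧ ‖F‖ = ‖f‖ := by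
  have hm : MemLp (fun x => ((‖f x‖ : ℝ) : ℂ)) 2 halfLineMeasure :=
    (Lp.memLp f).norm.ofReal
  refine ⟨hm.toLp _, hm.coeFn_toLp, le_antisymm ?_ ?_⟩
  · refine Lp.norm_le_norm_of_ae_le ?_
    filter_upwards [hm.coeFn_toLp] with x hx
    simp [hx]
  · refine Lp.norm_le_norm_of_ae_le ?_
    filter_upwards [hm.coeFn_toLp] with x hx
    simp [hx]

theorem exists_mul_operator {w : ℝ → ℝ} (hw : AEStronglyMeasurable w halfLineMeasure) {c : ℝ}
    (hc : ∀ x, 0 < x → |w x| ≤ c) :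
    ∃ M : HalfLineL2 →L[ℂ] HalfLineL2,
      (∀ f, M f =ᵐ[halfLineMeasure] fun x => (w x : ℂ) * f x) ∧ ∀ f, ‖M f‖ ≤ c * ‖f‖ := by
  have hW : MemLp (fun x => (w x : ℂ)) ∞ halfLineMeasure := by
    refine memLp_top_of_bound (Complex.continuous_ofReal.comp_aestronglyMeasurable hw) c ?_
    filter_upwards [ae_halfLine_pos] with x hx
    simpa using hc x hx
  have h : ∀ f, (ContinuousLinearMap.mul ℂ ℂ).holderL halfLineMeasure ∞ 2 2 (hW.toLp _) f
      =ᵐ[halfLineMeasure] fun x => (w x : ℂ) * f x := fun f => by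
    filter_upwards [(ContinuousLinearMap.mul ℂ ℂ).coeFn_holder (r := 2) (hW.toLp _) f,
      hW.coeFn_toLp] with x hx hx'
    refine hx.trans ?_
    rw [hx', ContinuousLinearMap.mul_apply']
  refine ⟨_, h, fun f => Lp.norm_le_mul_norm_of_ae_le_mul ?_⟩
  filter_upwards [h f, ae_halfLine_pos] with x hx hx0
  rw [hx, norm_mul, Complex.norm_real]
  exact mul_le_mul_of_nonneg_right (hc x hx0) (norm_nonneg _)

/-- Pointwise, `|∫ K₂ f| ≤ C ∫ K₁ |f| = C (T₁ |f|)(x)`, so absolute convergence, square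
integrability and the norm bound are all inherited from `T₁`. -/
theorem exists_operator_of_dominated_kernel {K₁ K₂ : ℝ → ℝ → ℝ}
    {T₁ : HalfLineL2 →L[ℂ] HalfLineL2} (hT₁ : HasIntegralKernel T₁ K₁)
    (hm : AEStronglyMeasurable (fun z : ℝ × ℝ => K₂ z.1 z.2)
      (halfLineMeasure.prod halfLineMeasure)) {C : ℝ} (hC : 0 ≤ C)
    (hpos : ∀ x y, 0 < x → 0 < y → 0 ≤ K₁ x y)
    (hle : ∀ x y, 0 < x → 0 < y → |K₂ x y| ≤ C * K₁ x y) :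
    ∃ T₂ : HalfLineL2 →L[ℂ] HalfLineL2, HasIntegralKernel T₂ K₂ := by
  have hbound : ∀ f : HalfLineL2, ∃ F : HalfLineL2, ‖F‖ = ‖f‖ ∧ ∀ᵐ x ∂halfLineMeasure,
      Integrable (fun y => (K₂ x y : ℂ) * f y) halfLineMeasure ∧
      ‖∫ y in Ioi (0 : ℝ), (K₂ x y : ℂ) * f y‖ ≤ C * ‖T₁ F x‖ := by
    intro f
    obtain ⟨F, hF, hFn⟩ := exists_norm_lp f
    refine ⟨F, hFn, ?_⟩
    filter_upwards [hT₁ F, hm.prodMk_left, ae_halfLine_pos] with x hx hmx hx0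
    have hdom : ∀ᵐ y ∂halfLineMeasure,
        ‖(K₂ x y : ℂ) * f y‖ ≤ C * ‖(K₁ x y : ℂ) * F y‖ := by
      filter_upwards [hF, ae_halfLine_pos] with y hy hy0
      rw [hy, norm_mul, norm_mul, Complex.norm_real, Complex.norm_real, Complex.norm_real,
        norm_norm, ← mul_assoc, Real.norm_eq_abs, Real.norm_of_nonneg (hpos x y hx0 hy0)]
      exact mul_le_mul_of_nonneg_right (hle x y hx0 hy0) (norm_nonneg _)
    have hint : Integrable (fun y => C * ‖(K₁ x y : ℂ) * F y‖) halfLineMeasure :=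
      hx.1.norm.const_mul C
    refine ⟨hint.mono' ((Complex.continuous_ofReal.comp_aestronglyMeasurable hmx).mul
      (Lp.aestronglyMeasurable f)) hdom, ?_⟩
    refine (norm_integral_le_of_norm_le hint hdom).trans (le_of_eq ?_)
    rw [integral_const_mul, hx.2]
    congr 1
    have h1 : ∫ y in Ioi (0 : ℝ), (K₁ x y : ℂ) * F y =
        ((∫ y in Ioi (0 : ℝ), ‖(K₁ x y : ℂ) * F y‖ : ℝ) : ℂ) := by
      rw [← integral_complex_ofReal]
      refine integral_congr_ae ?_
      filter_upwards [hF, ae_halfLine_pos] with y hy hy0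
      simp [hy, abs_of_nonneg (hpos x y hx0 hy0)]
    rw [h1, Complex.norm_real, Real.norm_of_nonneg (integral_nonneg fun _ => norm_nonneg _)]
  choose F hFn hF using hbound
  have hmem : ∀ f : HalfLineL2,
      MemLp (fun x => ∫ y in Ioi (0 : ℝ), (K₂ x y : ℂ) * f y) 2 halfLineMeasure := fun f => by
    refine MemLp.of_le_mul (c := C) (Lp.memLp (T₁ (F f))) ?_ ((hF f).mono fun x hx => hx.2)
    exact ((Complex.continuous_ofReal.comp_aestronglyMeasurable hm).mul
      (Lp.aestronglyMeasurable f).comp_snd).integral_prod_right'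
  have hcoe := fun f => (hmem f).coeFn_toLp
  let T : HalfLineL2 →ₗ[ℂ] HalfLineL2 :=
    { toFun := fun f => (hmem f).toLp _
      map_add' := fun f g => by
        refine Lp.ext ?_
        filter_upwards [hcoe (f + g), hcoe f, hcoe g, hF f, hF g,
          Lp.coeFn_add ((hmem f).toLp _) ((hmem g).toLp _)] with x h1 h2 h3 h4 h5 h6
        rw [h1, h6, Pi.add_apply, h2, h3, ← integral_add h4.1 h5.1]
        refine integral_congr_ae ?_
        filter_upwards [Lp.coeFn_add f g] with y hy
        rw [hy, Pi.add_apply, mul_add]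
      map_smul' := fun a f => by
        refine Lp.ext ?_
        filter_upwards [hcoe (a • f), hcoe f, Lp.coeFn_smul a ((hmem f).toLp _)] with x h1 h2 h3
        rw [h1, RingHom.id_apply, h3, Pi.smul_apply, h2, smul_eq_mul, ← integral_const_mul]
        refine integral_congr_ae ?_
        filter_upwards [Lp.coeFn_smul a f] with y hy
        rw [hy, Pi.smul_apply, smul_eq_mul]
        ring }
  have hTn : ∀ f, ‖T f‖ ≤ (C * ‖T₁‖) * ‖f‖ := fun f => by
    have h1 : ‖T f‖ ≤ C * ‖T₁ (F f)‖ := by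
      refine Lp.norm_le_mul_norm_of_ae_le_mul ?_
      filter_upwards [hcoe f, hF f] with x h1 h2
      change ‖((hmem f).toLp _ : HalfLineL2) x‖ ≤ _
      rw [h1]
      exact h2.2
    rw [mul_assoc, ← hFn f]
    exact h1.trans (mul_le_mul_of_nonneg_left (T₁.le_opNorm _) hC)
  refine ⟨T.mkContinuous _ hTn, fun f => ?_⟩
  filter_upwards [hcoe f, hF f] with x h1 h2
  exact ⟨h2.1, h1⟩

theorem ae_eq_zero_of_integral_Ioi_eq_zero {u : ℝ → ℂ} (hu : Integrable u halfLineMeasure)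
    (h : ∀ᵐ s ∂halfLineMeasure, ∫ x in Ioi s, u x = 0) : u =ᵐ[halfLineMeasure] 0 := by
  set v := (Ioi (0 : ℝ)).indicator u with hv
  have hvi : Integrable v := (integrable_indicator_iff measurableSet_Ioi).2 hu
  have hcont := hvi.continuous_primitive 0
  -- The primitive is constant almost everywhere, hence everywhere on `(0,∞)` by continuity;
  -- Lebesgue differentiation then gives `u = 0`.
  have hconst : EqOn (fun t => ∫ x in (0 : ℝ)..t, v x) (fun _ => ∫ x in Ioi (0 : ℝ), v x)
      (Ioi 0) := by
    refine Measure.eqOn_open_of_ae_eq (μ := volume) ?_ isOpen_Ioi hcont.continuousOn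
      continuousOn_const
    filter_upwards [h, ae_halfLine_pos] with t ht ht0
    have h1 : ∫ x in Ioi t, v x = 0 := by
      rw [← ht]
      exact setIntegral_congr_fun measurableSet_Ioi fun x hx =>
        indicator_of_mem (mem_Ioi.2 (ht0.trans hx)) u
    rw [intervalIntegral.integral_of_le ht0.le, ← Ioc_union_Ioi_eq_Ioi ht0.le,
      setIntegral_union (Ioc_disjoint_Ioi le_rfl) measurableSet_Ioi hvi.integrableOn
        hvi.integrableOn, h1, add_zero]
  filter_upwards [ae_restrict_of_ae (_root_.LocallyIntegrable.ae_hasDerivAt_integral hvi.locallyIntegrable),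
    ae_halfLine_pos] with t ht ht0
  have h2 : HasDerivAt (fun t => ∫ x in (0 : ℝ)..t, v x) 0 t :=
    (hasDerivAt_const t _).congr_of_eventuallyEq
      (hconst.eventuallyEq_of_mem (Ioi_mem_nhds ht0))
  have h3 := (ht 0).unique h2
  rwa [hv, indicator_of_mem (mem_Ioi.2 ht0)] at h3

/-- The quadratic form of the operator with kernel `p(x) p(y) ∫₀^{min(x,y)} h`. -/
theorem HasIntegralKernel.inner_self_eq {K : ℝ → ℝ → ℝ} {T : HalfLineL2 →L[ℂ] HalfLineL2}
    (hT : HasIntegralKernel T K) {p h : ℝ → ℝ}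
    (hp : AEStronglyMeasurable p halfLineMeasure) (hh : AEStronglyMeasurable h halfLineMeasure)
    (hp0 : ∀ x, 0 < x → 0 ≤ p x) (hh0 : ∀ x, 0 < x → 0 ≤ h x)
    (hhi : ∀ t, 0 < t → IntegrableOn h (Ioo 0 t))
    (hK : ∀ x y, 0 < x → 0 < y → K x y = p x * p y * ∫ s in Ioo 0 (min x y), h s)
    (f : HalfLineL2) :
    Integrable (fun s => h s * ‖∫ x in Ioi s, (p x : ℂ) * f x‖ ^ 2) halfLineMeasure ∧
    ⟪f, T f⟫_ℂ = ((∫ s in Ioi (0 : ℝ), h s * ‖∫ x in Ioi s, (p x : ℂ) * f x‖ ^ 2 : ℝ) : ℂ) := by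
  set u : ℝ → ℂ := fun x => (p x : ℂ) * f x with hu
  have hum : AEStronglyMeasurable u halfLineMeasure :=
    (Complex.continuous_ofReal.comp_aestronglyMeasurable hp).mul (Lp.aestronglyMeasurable f)
  let S : Set (ℝ × ℝ × ℝ) := {z | z.1 < z.2.1} ∩ {z | z.1 < z.2.2}
  have hS : MeasurableSet S :=
    (measurableSet_lt measurable_fst (measurable_fst.comp measurable_snd)).inter
      (measurableSet_lt measurable_fst (measurable_snd.comp measurable_snd))
  -- Integrating `F` over `s` first yields the kernel, over `(x, y)` first the squared tail
  -- integral.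
  let F : ℝ × ℝ × ℝ → ℂ := S.indicator fun z =>
    (h z.1 : ℂ) * (star (u z.2.1) * u z.2.2)
  have hFm : AEStronglyMeasurable F
      (halfLineMeasure.prod (halfLineMeasure.prod halfLineMeasure)) := by
    refine AEStronglyMeasurable.indicator ?_ hS
    exact (Complex.continuous_ofReal.comp_aestronglyMeasurable hh.comp_fst).mul
      ((continuous_star.comp_aestronglyMeasurable hum.comp_fst.comp_snd).mul
        hum.comp_snd.comp_snd)
  have hFs : ∀ x y, 0 < x → 0 < y → ∀ᵐ s ∂halfLineMeasure, F (s, x, y) =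
      (Ioo 0 (min x y)).indicator (fun s => (h s : ℂ) * (star (u x) * u y)) s := by
    intro x y hx hy
    filter_upwards [ae_halfLine_pos] with s hs
    by_cases hsm : s < x ∧ s < y
    · rw [indicator_of_mem (show s ∈ Ioo 0 (min x y) from ⟨hs, lt_min hsm.1 hsm.2⟩)]
      exact indicator_of_mem (show (s, x, y) ∈ S from hsm) _
    · rw [indicator_of_notMem (fun h' => hsm (lt_min_iff.1 h'.2))]
      exact indicator_of_notMem (show (s, x, y) ∉ S from hsm) _
  have hsub : ∀ t : ℝ, halfLineMeasure.restrict (Ioo 0 t) = volume.restrict (Ioo 0 t) :=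
    fun t => Measure.restrict_restrict_of_subset Ioo_subset_Ioi_self
  have hFi : ∀ x y, 0 < x → 0 < y → Integrable (fun s => F (s, x, y)) halfLineMeasure := by
    intro x y hx hy
    rw [integrable_congr (hFs x y hx hy), integrable_indicator_iff measurableSet_Ioo,
      IntegrableOn, hsub]
    exact (hhi _ (lt_min hx hy)).ofReal.mul_const _
  have hFint : ∀ x y, 0 < x → 0 < y →
      ∫ s, F (s, x, y) ∂halfLineMeasure = (K x y : ℂ) * (star (f x) * f y) := by
    intro x y hx hy
    rw [integral_congr_ae (hFs x y hx hy), integral_indicator measurableSet_Ioo, hsub,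
      integral_mul_const, integral_complex_ofReal, hK x y hx hy, hu]
    simp only [star_mul', Complex.star_def, Complex.conj_ofReal]
    push_cast
    ring
  have hFnorm : ∀ x y, 0 < x → 0 < y →
      ∫ s, ‖F (s, x, y)‖ ∂halfLineMeasure = K x y * (‖f x‖ * ‖f y‖) := by
    intro x y hx hy
    have h1 : ∀ᵐ s ∂halfLineMeasure, ‖F (s, x, y)‖ =
        (Ioo 0 (min x y)).indicator (fun s => h s * (‖u x‖ * ‖u y‖)) s := by
      filter_upwards [hFs x y hx hy, ae_halfLine_pos] with s hs hs0
      rw [hs, norm_indicator_eq_indicator_norm]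
      by_cases hs1 : s ∈ Ioo 0 (min x y)
      · simp [indicator_of_mem hs1, abs_of_nonneg (hh0 s hs0)]
      · simp [indicator_of_notMem hs1]
    rw [integral_congr_ae h1, integral_indicator measurableSet_Ioo, hsub, integral_mul_const,
      hK x y hx hy, hu]
    simp only [norm_mul, Complex.norm_real, Real.norm_of_nonneg (hp0 x hx),
      Real.norm_of_nonneg (hp0 y hy)]
    ring
  have hK0 : ∀ x y, 0 < x → 0 < y → 0 ≤ K x y := fun x y hx hy => by
    rw [hK x y hx hy]
    refine mul_nonneg (mul_nonneg (hp0 x hx) (hp0 y hy)) ?_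
    exact setIntegral_nonneg measurableSet_Ioo fun s hs => hh0 s hs.1
  -- Tonelli reduces this to finiteness of `∫ |f| · T|f|`, a product of two `L²` functions.
  have hFI : Integrable F (halfLineMeasure.prod (halfLineMeasure.prod halfLineMeasure)) := by
    rw [integrable_prod_iff' hFm]
    refine ⟨ae_prod_halfLine_pos.mono fun z hz => hFi z.1 z.2 hz.1 hz.2, ?_⟩
    rw [integrable_prod_iff (by exact hFm.prod_swap.norm.integral_prod_right')]
    obtain ⟨G, hG, -⟩ := exists_norm_lp f
    constructor
    · filter_upwards [hT f, ae_halfLine_pos] with x hx hx0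
      refine (hx.1.norm.const_mul ‖f x‖).congr ?_
      filter_upwards [ae_halfLine_pos] with y hy0
      change _ = ∫ s, ‖F (s, x, y)‖ ∂halfLineMeasure
      rw [hFnorm x y hx0 hy0, norm_mul, Complex.norm_real, Real.norm_of_nonneg (hK0 x y hx0 hy0)]
      ring
    · have h2 := (Lp.memLp f).norm.integrable_mul (Lp.memLp (T G)).norm
      refine h2.congr ?_
      filter_upwards [hT G, ae_halfLine_pos] with x hx hx0
      have h3 : ∫ y in Ioi (0 : ℝ), (K x y : ℂ) * G y =
          ((∫ y in Ioi (0 : ℝ), K x y * ‖f y‖ : ℝ) : ℂ) := by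
        rw [← integral_complex_ofReal]
        refine integral_congr_ae ?_
        filter_upwards [hG] with y hy
        simp [hy]
      have h4 : 0 ≤ ∫ y in Ioi (0 : ℝ), K x y * ‖f y‖ :=
        setIntegral_nonneg measurableSet_Ioi fun y hy =>
          mul_nonneg (hK0 x y hx0 hy) (norm_nonneg _)
      rw [Pi.mul_apply, hx.2, h3, Complex.norm_real, Real.norm_of_nonneg h4,
        ← integral_const_mul]
      refine integral_congr_ae ?_
      filter_upwards [ae_halfLine_pos] with y hy0
      change _ = ‖∫ s, ‖F (s, x, y)‖ ∂halfLineMeasure‖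
      rw [hFnorm x y hx0 hy0, Real.norm_of_nonneg
        (mul_nonneg (hK0 x y hx0 hy0) (by positivity))]
      ring
  have hinner : ∀ᵐ s ∂halfLineMeasure,
      ∫ z, F (s, z) ∂(halfLineMeasure.prod halfLineMeasure) =
        ((h s * ‖∫ x in Ioi s, u x‖ ^ 2 : ℝ) : ℂ) := by
    filter_upwards [ae_halfLine_pos] with s hs
    have h1 : ∀ z : ℝ × ℝ, F (s, z) =
        (h s : ℂ) * ((Ioi s).indicator (fun x => star (u x)) z.1 * (Ioi s).indicator u z.2) := by
      rintro ⟨x, y⟩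
      by_cases hx : s < x <;> by_cases hy : s < y <;> simp [F, S, indicator, hx, hy]
    have hsub' : halfLineMeasure.restrict (Ioi s) = volume.restrict (Ioi s) :=
      Measure.restrict_restrict_of_subset (Ioi_subset_Ioi hs.le)
    simp_rw [h1]
    rw [integral_const_mul, integral_prod_mul, integral_indicator measurableSet_Ioi,
      integral_indicator measurableSet_Ioi, hsub']
    have h2 : ∫ x in Ioi s, star (u x) = star (∫ x in Ioi s, u x) := integral_conj
    rw [h2, Complex.star_def, Complex.conj_mul']
    push_cast
    ring
  refine ⟨?_, ?_⟩
  · exact (hFI.integral_prod_left.congr hinner).re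
  · rw [← integral_complex_ofReal, ← integral_congr_ae hinner,
      integral_integral_swap (f := fun s z => F (s, z)) hFI, L2.inner_def]
    rw [integral_prod _ hFI.integral_prod_right]
    refine integral_congr_ae ?_
    filter_upwards [hT f, ae_halfLine_pos] with x hx hx0
    rw [hx.2, RCLike.inner_apply', ← integral_const_mul]
    refine integral_congr_ae ?_
    filter_upwards [ae_halfLine_pos] with y hy0
    rw [hFint x y hx0 hy0]
    simp only [Complex.star_def]
    ring

/-- Indicators of the intervals `(n, n + 1]` form an infinite orthonormal family. -/
theorem not_finiteDimensional_halfLineL2 : ¬ FiniteDimensional ℂ HalfLineL2 := by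
  intro hfd
  have hfin : ∀ n : ℕ, halfLineMeasure (Ioc (n : ℝ) (n + 1)) ≠ ∞ := fun n =>
    ((Measure.restrict_apply_le _ _).trans_lt measure_Ioc_lt_top).ne
  let e : ℕ → HalfLineL2 := fun n => indicatorConstLp 2 measurableSet_Ioc (hfin n) (1 : ℂ)
  have hval : ∀ n m : ℕ, ⟪e n, e m⟫_ℂ =
      (halfLineMeasure.real (Ioc (n : ℝ) (n + 1) ∩ Ioc (m : ℝ) (m + 1)) : ℂ) := fun n m =>
    L2.inner_indicatorConstLp_one_indicatorConstLp_one _ _ _ _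
  have horth : Orthonormal ℂ e := by
    rw [orthonormal_iff_ite]
    intro n m
    rw [hval]
    split_ifs with h
    · subst h
      rw [inter_self, Measure.real, Measure.restrict_apply measurableSet_Ioc,
        
        inter_eq_left.2 (show Ioc (n : ℝ) (n + 1) ⊆ Ioi 0 from
          fun x hx => lt_of_le_of_lt n.cast_nonneg hx.1)]
      simp
    · have : Ioc (n : ℝ) (n + 1) ∩ Ioc (m : ℝ) (m + 1) = ∅ := by
        refine Set.eq_empty_of_forall_notMem fun x hx => h ?_
        have h1 : (n : ℝ) < m + 1 := hx.1.1.trans_le hx.2.2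
        have h2 : (m : ℝ) < n + 1 := hx.2.1.trans_le hx.1.2
        norm_cast at h1 h2
        omega
      simp [this]
  have := horth.linearIndependent.finite
  exact not_finite ℕ

end HalfLine

/-! ### Green functions and their comparison -/

section Green

variable {φ φ₁ φ₂ : ℝ → ℝ}

theorem greenFunction_eq {x y : ℝ} (hx : 0 < x) (hy : 0 < y) :
    greenFunction φ x y = φ x * φ y * ∫ s in Ioo 0 (min x y), 1 / φ s ^ 2 := by
  rw [← integral_Ioc_eq_integral_Ioo, ← intervalIntegral.integral_of_le (lt_min hx hy).le,
    greenFunction, secondSolution, secondSolution]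
  split_ifs with h
  · rw [min_eq_left h]; ring
  · rw [min_eq_right (le_of_not_ge h)]; ring

theorem IsSubordinate.continuousOn_one_div_sq (h : IsSubordinate φ) :
    ContinuousOn (fun s => 1 / φ s ^ 2) (Ici 0) :=
  continuousOn_const.div (h.memW12Loc.1.pow 2) fun x hx => (pow_pos (h.pos x hx) 2).ne'

theorem IsSubordinate.integrableOn_one_div_sq (h : IsSubordinate φ) (t : ℝ) :
    IntegrableOn (fun s => 1 / φ s ^ 2) (Ioo 0 t) :=
  ((h.continuousOn_one_div_sq.mono Icc_subset_Ici_self).integrableOn_Icc (b := t)).mono_set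
    Ioo_subset_Icc_self

theorem ContinuousOn.aestronglyMeasurable_halfLine {g : ℝ → ℝ} (h : ContinuousOn g (Ici 0)) :
    AEStronglyMeasurable g halfLineMeasure :=
  (h.mono Ioi_subset_Ici_self).aestronglyMeasurable measurableSet_Ioi

theorem IsSubordinate.greenFunction_nonneg (h : IsSubordinate φ) {x y : ℝ} (hx : 0 < x)
    (hy : 0 < y) : 0 ≤ greenFunction φ x y := by
  rw [greenFunction_eq hx hy]
  refine mul_nonneg (mul_pos (h.pos x hx.le) (h.pos y hy.le)).le ?_
  exact setIntegral_nonneg measurableSet_Ioo fun s _ => by positivity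

theorem IsSubordinate.aestronglyMeasurable_greenFunction (h : IsSubordinate φ) :
    AEStronglyMeasurable (fun z : ℝ × ℝ => greenFunction φ z.1 z.2)
      (halfLineMeasure.prod halfLineMeasure) := by
  have hφ := h.memW12Loc.1.aestronglyMeasurable_halfLine
  -- Composing with `max 0` avoids the values of `φ` on the negative axis and gives a globally
  -- continuous integrand.
  set g : ℝ → ℝ := fun s => 1 / φ (max 0 s) ^ 2 with hg
  have hgc : Continuous g := by
    have := h.continuousOn_one_div_sq.comp_continuous (f := fun s : ℝ => max 0 s) (by fun_prop)
      (fun s => mem_Ici.2 (le_max_left _ _))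
    exact this
  have hG : Continuous fun t => ∫ s in (0 : ℝ)..t, g s :=
    intervalIntegral.continuous_primitive (fun a b => hgc.intervalIntegrable a b) 0
  have hG2 : Continuous fun z : ℝ × ℝ => ∫ s in (0 : ℝ)..(min z.1 z.2), g s :=
    hG.comp (continuous_fst.min continuous_snd)
  refine ((hφ.comp_fst.mul hφ.comp_snd).mul hG2.aestronglyMeasurable).congr ?_
  filter_upwards [ae_prod_halfLine_pos] with z hz
  rw [greenFunction_eq hz.1 hz.2, Pi.mul_apply, Pi.mul_apply,
    intervalIntegral.integral_of_le (lt_min hz.1 hz.2).le, integral_Ioc_eq_integral_Ioo]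
  congr 1
  exact setIntegral_congr_fun measurableSet_Ioo fun s hs => by simp [hg, max_eq_right hs.1.le]

/-- `φ₁` and `φ₂` agree on `[0,∞)` up to factors in `[c⁻¹, c]`. -/
def ComparableBy (c : ℝ) (φ₁ φ₂ : ℝ → ℝ) : Prop :=
  ∀ x, 0 ≤ x → φ₂ x ≤ c * φ₁ x ∧ φ₁ x ≤ c * φ₂ x

theorem ComparableBy.symm {c : ℝ} (h : ComparableBy c φ₁ φ₂) : ComparableBy c φ₂ φ₁ :=
  fun x hx => (h x hx).symm

theorem ComparableBy.one_div_sq_le {c : ℝ} (h : ComparableBy c φ₁ φ₂) (h₁ : IsSubordinate φ₁)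
    (h₂ : IsSubordinate φ₂) {s : ℝ} (hs : 0 ≤ s) :
    1 / φ₂ s ^ 2 ≤ c ^ 2 * (1 / φ₁ s ^ 2) := by
  have h1 := h₁.pos s hs
  have h2 := h₂.pos s hs
  rw [mul_one_div, div_le_div_iff₀ (by positivity) (by positivity), one_mul, ← mul_pow]
  exact pow_le_pow_left₀ h1.le (h s hs).2 2

/-- Each of the two outer factors costs `c`, the integrand `c²`. -/
theorem ComparableBy.greenFunction_le {c : ℝ} (hc : 0 < c) (h : ComparableBy c φ₁ φ₂)
    (h₁ : IsSubordinate φ₁) (h₂ : IsSubordinate φ₂) {x y : ℝ} (hx : 0 < x) (hy : 0 < y) :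
    greenFunction φ₂ x y ≤ c ^ 4 * greenFunction φ₁ x y := by
  rw [greenFunction_eq hx hy, greenFunction_eq hx hy]
  have hI : ∫ s in Ioo 0 (min x y), 1 / φ₂ s ^ 2 ≤
      c ^ 2 * ∫ s in Ioo 0 (min x y), 1 / φ₁ s ^ 2 := by
    rw [← integral_const_mul]
    exact setIntegral_mono_on (h₂.integrableOn_one_div_sq _)
      ((h₁.integrableOn_one_div_sq _).const_mul _) measurableSet_Ioo
      fun s hs => h.one_div_sq_le h₁ h₂ hs.1.le
  have hp : φ₂ x * φ₂ y ≤ (c * φ₁ x) * (c * φ₁ y) :=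
    mul_le_mul (h x hx.le).1 (h y hy.le).1 (h₂.pos y hy.le).le
      (mul_pos hc (h₁.pos x hx.le)).le
  calc _ ≤ (c * φ₁ x) * (c * φ₁ y) * (c ^ 2 * ∫ s in Ioo 0 (min x y), 1 / φ₁ s ^ 2) :=
        mul_le_mul hp hI (setIntegral_nonneg measurableSet_Ioo fun s _ => by positivity)
          (mul_pos (mul_pos hc (h₁.pos x hx.le)) (mul_pos hc (h₁.pos y hy.le))).le
    _ = _ := by ring

theorem ComparableBy.greenBounded {c : ℝ} (hc : 0 < c) (h : ComparableBy c φ₁ φ₂)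
    (h₁ : IsSubordinate φ₁) (h₂ : IsSubordinate φ₂) (hb : GreenBounded φ₁) : GreenBounded φ₂ := by
  obtain ⟨T₁, hT₁⟩ := hb
  refine exists_operator_of_dominated_kernel hT₁ h₂.aestronglyMeasurable_greenFunction
    (pow_pos hc 4).le (fun x y hx hy => h₁.greenFunction_nonneg hx hy) fun x y hx hy => ?_
  rw [abs_of_nonneg (h₂.greenFunction_nonneg hx hy)]
  exact h.greenFunction_le hc h₁ h₂ hx hy

theorem IsSubordinate.inner_self_eq (h : IsSubordinate φ) {T : HalfLineL2 →L[ℂ] HalfLineL2}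
    (hT : HasIntegralKernel T (greenFunction φ)) (f : HalfLineL2) :
    Integrable (fun s => 1 / φ s ^ 2 * ‖∫ x in Ioi s, (φ x : ℂ) * f x‖ ^ 2) halfLineMeasure ∧
    ⟪T f, f⟫_ℂ =
      ((∫ s in Ioi (0 : ℝ), 1 / φ s ^ 2 * ‖∫ x in Ioi s, (φ x : ℂ) * f x‖ ^ 2 : ℝ) : ℂ) := by
  have := hT.inner_self_eq h.memW12Loc.1.aestronglyMeasurable_halfLine
    h.continuousOn_one_div_sq.aestronglyMeasurable_halfLine (fun x hx => (h.pos x hx.le).le)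
    (fun x _ => by positivity) (fun t _ => h.integrableOn_one_div_sq t)
    (fun x y hx hy => greenFunction_eq hx hy) f
  refine ⟨this.1, ?_⟩
  rw [← inner_conj_symm, this.2, Complex.conj_ofReal]

/-- On a complex Hilbert space a real quadratic form suffices. -/
theorem IsSubordinate.isSymmetric (h : IsSubordinate φ) {T : HalfLineL2 →L[ℂ] HalfLineL2}
    (hT : HasIntegralKernel T (greenFunction φ)) : (T : HalfLineL2 →ₗ[ℂ] HalfLineL2).IsSymmetric :=
  LinearMap.isSymmetric_iff_inner_map_self_real _ |>.2 fun f => by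
    rw [ContinuousLinearMap.coe_coe, (h.inner_self_eq hT f).2, Complex.conj_ofReal]

theorem IsSubordinate.inner_self_nonneg (h : IsSubordinate φ) {T : HalfLineL2 →L[ℂ] HalfLineL2}
    (hT : HasIntegralKernel T (greenFunction φ)) (f : HalfLineL2) : 0 ≤ (⟪T f, f⟫_ℂ).re := by
  rw [(h.inner_self_eq hT f).2, Complex.ofReal_re]
  exact integral_nonneg fun s => by positivity

theorem IsSubordinate.inner_self_pos (h : IsSubordinate φ) {T : HalfLineL2 →L[ℂ] HalfLineL2}
    (hT : HasIntegralKernel T (greenFunction φ)) {f : HalfLineL2} (hf : f ≠ 0) :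
    0 < (⟪T f, f⟫_ℂ).re := by
  refine lt_of_le_of_ne (h.inner_self_nonneg hT f) fun h0 => hf ?_
  rw [(h.inner_self_eq hT f).2, Complex.ofReal_re, eq_comm,
    integral_eq_zero_iff_of_nonneg (fun s => by positivity) (h.inner_self_eq hT f).1] at h0
  -- Since `φ` is in `L²`, `φ f` is integrable; a zero form makes its tail integrals vanish, which
  -- forces `f = 0`.
  have hint : Integrable (fun x => (φ x : ℂ) * f x) halfLineMeasure :=
    (h.memL2.ofReal (K := ℂ)).integrable_mul (Lp.memLp f)
  have hz := ae_eq_zero_of_integral_Ioi_eq_zero hint (by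
    filter_upwards [h0, ae_halfLine_pos] with s hs hs0
    have h1 : 1 / φ s ^ 2 ≠ 0 := by
      have := h.pos s hs0.le
      positivity
    simpa using (mul_eq_zero.1 hs).resolve_left h1)
  refine Lp.ext ?_
  filter_upwards [hz, ae_halfLine_pos, Lp.coeFn_zero ℂ 2 halfLineMeasure] with x hx hx0 hx1
  rw [hx1]
  exact (mul_eq_zero.1 hx).resolve_left (Complex.ofReal_ne_zero.2 (h.pos x hx0.le).ne')

theorem ComparableBy.exists_inner_self_le {c : ℝ} (h : ComparableBy c φ₁ φ₂)
    (h₁ : IsSubordinate φ₁) (h₂ : IsSubordinate φ₂) {G₁ G₂ : HalfLineL2 →L[ℂ] HalfLineL2}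
    (hG₁ : HasIntegralKernel G₁ (greenFunction φ₁))
    (hG₂ : HasIntegralKernel G₂ (greenFunction φ₂)) :
    ∃ M : HalfLineL2 →L[ℂ] HalfLineL2, (∀ f, ‖M f‖ ^ 2 ≤ c ^ 2 * ‖f‖ ^ 2) ∧
      ∀ f, (⟪G₂ f, f⟫_ℂ).re ≤ c ^ 2 * (⟪G₁ (M f), M f⟫_ℂ).re := by
  obtain ⟨M, hM, hMn⟩ := exists_mul_operator (w := fun x => φ₂ x / φ₁ x) (c := c)
    (h₂.memW12Loc.1.div h₁.memW12Loc.1 fun x hx =>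
      (h₁.pos x hx).ne').aestronglyMeasurable_halfLine (fun x hx => by
        rw [abs_of_pos (div_pos (h₂.pos x hx.le) (h₁.pos x hx.le)), div_le_iff₀ (h₁.pos x hx.le)]
        exact (h x hx.le).1)
  refine ⟨M, fun f => ?_, fun f => ?_⟩
  · rw [← mul_pow]
    exact pow_le_pow_left₀ (norm_nonneg _) (hMn f) 2
  · rw [(h₂.inner_self_eq hG₂ f).2, (h₁.inner_self_eq hG₁ (M f)).2, Complex.ofReal_re,
      Complex.ofReal_re, ← integral_const_mul]
    refine integral_mono_ae (h₂.inner_self_eq hG₂ f).1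
      ((h₁.inner_self_eq hG₁ (M f)).1.const_mul _) ?_
    filter_upwards [ae_halfLine_pos] with s hs
    have hI : ∫ x in Ioi s, (φ₁ x : ℂ) * M f x = ∫ x in Ioi s, (φ₂ x : ℂ) * f x := by
      refine integral_congr_ae ?_
      filter_upwards [ae_restrict_of_ae_restrict_of_subset (Ioi_subset_Ioi hs.le) (hM f),
        ae_restrict_mem measurableSet_Ioi] with x hx hxs
      have hne : (φ₁ x : ℂ) ≠ 0 := Complex.ofReal_ne_zero.2 (h₁.pos x (hs.trans hxs).le).ne'
      rw [hx]
      push_cast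
      field_simp
    rw [hI, ← mul_assoc]
    exact mul_le_mul_of_nonneg_right (h.one_div_sq_le h₁ h₂ hs.le) (by positivity)

theorem ComparableBy.isCompactOperator {c : ℝ} (hc : 0 < c) (h : ComparableBy c φ₁ φ₂)
    (h₁ : IsSubordinate φ₁) (h₂ : IsSubordinate φ₂) {G₁ G₂ : HalfLineL2 →L[ℂ] HalfLineL2}
    (hG₁ : HasIntegralKernel G₁ (greenFunction φ₁))
    (hG₂ : HasIntegralKernel G₂ (greenFunction φ₂)) (hcpt : IsCompactOperator G₁) :
    IsCompactOperator G₂ := by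
  obtain ⟨M, hM, hle⟩ := h.exists_inner_self_le h₁ h₂ hG₁ hG₂
  -- The constant `c² · c` below combines the form comparison with `‖M f‖ ≤ c ‖f‖`.
  have hK : IsCompactOperator (G₁.comp M) := hcpt.comp_clm M
  refine hK.of_quadratic_form_le (h₂.isSymmetric hG₂) (h₂.inner_self_nonneg hG₂)
    (C := c ^ 2 * c) fun f => (hle f).trans ?_
  have h1 : ‖M f‖ ≤ c * ‖f‖ :=
    le_of_sq_le_sq ((hM f).trans_eq (mul_pow _ _ _).symm) (by positivity)
  have h2 : (⟪G₁ (M f), M f⟫_ℂ).re ≤ ‖G₁ (M f)‖ * (c * ‖f‖) :=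
    (Complex.re_le_norm _).trans ((norm_inner_le_norm _ _).trans (by gcongr))
  calc c ^ 2 * (⟪G₁ (M f), M f⟫_ℂ).re ≤ c ^ 2 * (‖G₁ (M f)‖ * (c * ‖f‖)) := by gcongr
    _ = _ := by rw [ContinuousLinearMap.comp_apply]; ring

theorem ComparableBy.greenCompact {c : ℝ} (hc : 0 < c) (h : ComparableBy c φ₁ φ₂)
    (h₁ : IsSubordinate φ₁) (h₂ : IsSubordinate φ₂) (hcpt : GreenCompact φ₁) :
    GreenCompact φ₂ := by
  obtain ⟨G₁, hG₁, hcpt⟩ := hcpt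
  obtain ⟨G₂, hG₂⟩ := h.greenBounded hc h₁ h₂ ⟨G₁, hG₁⟩
  exact ⟨G₂, hG₂, h.isCompactOperator hc h₁ h₂ hG₁ hG₂ hcpt⟩

theorem IsSubordinate.exists_isEigenvalueSequence (h : IsSubordinate φ)
    {G : HalfLineL2 →L[ℂ] HalfLineL2} (hG : HasIntegralKernel G (greenFunction φ))
    (hcpt : IsCompactOperator G) : ∃ μ : ℕ → ℝ, IsEigenvalueSequence G μ := by
  obtain ⟨-, μ, hμ, -, hcard⟩ := exists_hilbertBasis_antitone_eigenvalues
    not_finiteDimensional_halfLineL2 hcpt (h.isSymmetric hG) fun f hf => h.inner_self_pos hG hf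
  exact ⟨μ, hμ, hcard⟩

/-- Lets any admissible sequence, not just the constructed one, enter the min-max argument. -/
theorem IsSubordinate.exists_hilbertBasis (h : IsSubordinate φ)
    {G : HalfLineL2 →L[ℂ] HalfLineL2} (hG : HasIntegralKernel G (greenFunction φ))
    (hcpt : IsCompactOperator G) {μ : ℕ → ℝ} (hμ : IsEigenvalueSequence G μ) :
    (∃ b : HilbertBasis ℕ ℂ HalfLineL2, ∀ n, G (b n) = (μ n : ℂ) • b n) ∧ ∀ n, 0 ≤ μ n := by
  obtain ⟨b₀, μ₀, -, hb₀, hcard⟩ := exists_hilbertBasis_antitone_eigenvalues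
    not_finiteDimensional_halfLineL2 hcpt (h.isSymmetric hG) fun f hf => h.inner_self_pos hG hf
  obtain ⟨b, hb⟩ := b₀.exists_of_mk_eq_mk hb₀ fun z => (hμ.2 z).trans (hcard z).symm
  refine ⟨⟨b, hb⟩, fun n => ?_⟩
  have := h.inner_self_nonneg hG (b n)
  rw [hb, inner_smul_left, Complex.conj_ofReal, inner_self_eq_norm_sq_to_K,
    b.orthonormal.1] at this
  simpa using this

theorem ComparableBy.eigenvalue_le {c : ℝ} (hc : 0 < c) (h : ComparableBy c φ₁ φ₂)
    (h₁ : IsSubordinate φ₁) (h₂ : IsSubordinate φ₂) {G₁ G₂ : HalfLineL2 →L[ℂ] HalfLineL2}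
    (hG₁ : HasIntegralKernel G₁ (greenFunction φ₁))
    (hG₂ : HasIntegralKernel G₂ (greenFunction φ₂))
    (hcpt₁ : IsCompactOperator G₁) (hcpt₂ : IsCompactOperator G₂) {μ₁ μ₂ : ℕ → ℝ}
    (hμ₁ : IsEigenvalueSequence G₁ μ₁) (hμ₂ : IsEigenvalueSequence G₂ μ₂) (n : ℕ) :
    μ₂ n ≤ c ^ 4 * μ₁ n := by
  obtain ⟨M, hM, hle⟩ := h.exists_inner_self_le h₁ h₂ hG₁ hG₂
  obtain ⟨⟨b₁, hb₁⟩, hpos⟩ := h₁.exists_hilbertBasis hG₁ hcpt₁ hμ₁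
  obtain ⟨⟨b₂, hb₂⟩, -⟩ := h₂.exists_hilbertBasis hG₂ hcpt₂ hμ₂
  have := eigenvalue_le_of_quadratic_form_le (h₁.isSymmetric hG₁) (h₂.isSymmetric hG₂) hb₁ hb₂
    hμ₁.1 hμ₂.1 hpos M (by positivity) hM hle n
  rwa [← pow_mul] at this

end Green

theorem theorem6p1 (φ₁ φ₂ : ℝ → ℝ) (h₁ : IsSubordinate φ₁) (h₂ : IsSubordinate φ₂)
    (c : ℝ) (hc : 0 < c)
    (hφ : ∀ x : ℝ, 0 ≤ x → c⁻¹ ≤ φ₂ x / φ₁ x ∧ φ₂ x / φ₁ x ≤ c) :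
    (GreenBounded φ₁ ↔ GreenBounded φ₂) ∧
    (GreenCompact φ₁ ↔ GreenCompact φ₂) ∧
    ∀ G₁ G₂ : HalfLineL2 →L[ℂ] HalfLineL2,
      HasIntegralKernel G₁ (greenFunction φ₁) → HasIntegralKernel G₂ (greenFunction φ₂) →
      IsCompactOperator G₁ →
        (∃ μ₁ : ℕ → ℝ, IsEigenvalueSequence G₁ μ₁) ∧
        (∃ μ₂ : ℕ → ℝ, IsEigenvalueSequence G₂ μ₂) ∧
        ∀ μ₁ μ₂ : ℕ → ℝ, IsEigenvalueSequence G₁ μ₁ → IsEigenvalueSequence G₂ μ₂ →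
          ∀ n : ℕ, (c ^ 4)⁻¹ * μ₁ n ≤ μ₂ n ∧ μ₂ n ≤ c ^ 4 * μ₁ n := by
  have h : ComparableBy c φ₁ φ₂ := fun x hx => by
    have h1 := h₁.pos x hx
    obtain ⟨hl, hu⟩ := hφ x hx
    refine ⟨(div_le_iff₀ h1).1 hu, ?_⟩
    rw [le_div_iff₀ h1, inv_mul_le_iff₀ hc] at hl
    exact hl
  refine ⟨⟨h.greenBounded hc h₁ h₂, h.symm.greenBounded hc h₂ h₁⟩,
    ⟨h.greenCompact hc h₁ h₂, h.symm.greenCompact hc h₂ h₁⟩, fun G₁ G₂ hG₁ hG₂ hcpt₁ => ?_⟩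
  have hcpt₂ := h.isCompactOperator hc h₁ h₂ hG₁ hG₂ hcpt₁
  refine ⟨h₁.exists_isEigenvalueSequence hG₁ hcpt₁, h₂.exists_isEigenvalueSequence hG₂ hcpt₂,
    fun μ₁ μ₂ hμ₁ hμ₂ n => ⟨?_, h.eigenvalue_le hc h₁ h₂ hG₁ hG₂ hcpt₁ hcpt₂ hμ₁ hμ₂ n⟩⟩
  -- The lower bound is the upper bound with the two functions exchanged.
  rw [inv_mul_le_iff₀ (pow_pos hc 4)]
  exact h.symm.eigenvalue_le hc h₂ h₁ hG₂ hG₁ hcpt₂ hcpt₁ hμ₂ hμ₁ n
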